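/- For $p\in\{1,2\}$ and measurable $f:\mathbb{R}\to\mathbb{C}$ put $\|f\|_{B^p}=\bigl(\limsup_{l\to\infty}\frac1{2l}\int_{-l}^{l}|f(t)|^p\,dt\bigr)^{1/p}$. Let $B^p(\mathbb{R},\mathbb{C})$ be the set of measurable $f$ such that for every $\varepsilon>0$ there is a trigonometric polynomial $P(t)=\sum_{k=1}^{m}c_ke^{i\mu_kt}$ ($\mu_k\in\mathbb{R}$, $c_k\in\mathbb{C}$) with $\|f-P\|_{B^p}<\varepsilon$; write $B=B^1$. As an element of the space $B$, a function stands for its class modulo the relation $\|f-g\|_{B^1}=0$, and $f\in B$ is said to belong to $B^2$ as an element of $B$ if its class contains a function of $B^2(\mathbb{R},\mathbb{C})$. Let $\Lambda=\{\lambda_1,\lambda_2,\dots\}$ be a finite or countably infinite set of distinct real numbers. The series $\sum_j a_je^{i\lambda_jt}$ (with $a_j\in\mathbb{C}$, possibly zero) is the Fourier series of $f\in B$ if the mean value $\lim_{l\to\infty}\frac1{2l}\int_{-l}^{l}f(t)e^{-i\lambda t}\,dt$ equals $a_j$ for $\lambda=\lambda_j$ and equals $0$ for every real $\lambda\notin\Lambda$.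 The formal series $\sum_j a_je^{i\lambda_jt}$ is equivalent to $\sum_j b_je^{i\lambda_jt}$ if for each integer $n$ with $1\le n\le\sharp\Lambda$ there is a $\mathbb{Q}$-linear map $\psi_n:V_n\to\mathbb{R}$, where $V_n$ is the $\mathbb{Q}$-vector space generated by $\lambda_1,\dots,\lambda_n$, such that $b_j=a_je^{i\psi_n(\lambda_j)}$ for $j=1,\dots,n$. Two functions in $B$ are equivalent if, over some common countable set of exponents $\Lambda$, the Fourier series of the first is equivalent to that of the second. 1. Let $f_1\in B^2(\mathbb{R},\mathbb{C})$ have Fourier series $\sum_j a_je^{i\lambda_jt}$, where the $\lambda_j$ are distinct, and let $b_j\in\mathbb{C}$ be such that $\sum_j b_je^{i\lambda_jt}$ is equivalent to $\sum_j a_je^{i\lambda_jt}$. Then there is a function $f_2\in B^2(\mathbb{R},\mathbb{C})$ whose Fourier series is $\sum_j b_je^{i\lambda_jt}$, and $f_1$ is equivalent to $f_2$. 2. Let $f_1,f_2\in B$ be equivalent. If $f_1$ belongs to $B^2$ as an element of $B$ (in particular, if $f_1\in B^2(\mathbb{R},\mathbb{C})$), then $f_2$ also belongs to $B^2$ as an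 element of $B$. -/

import Mathlib

open Filter Topology MeasureTheory
open scoped ENNReal

noncomputable section

namespace Besicovitch

/-- The functions `t ↦ ∑ a_k e^{i λ_k t}` (finite sums, `λ_k` real, `a_k` complex). -/
def IsTrigPolynomial (P : ℝ → ℂ) : Prop :=
  ∃ (s : Finset ℝ) (c : ℝ → ℂ),
    ∀ t : ℝ, P t = ∑ x ∈ s, c x * Complex.exp (Complex.I * (x : ℂ) * (t : ℂ))

/-- The Besicovitch seminorm
`(limsup_{l → ∞} (2l)⁻¹ ∫_{-l}^{l} |f(t)|^p dt)^{1/p}`, with values in `[0, ∞]`. -/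
def seminorm (p : ℝ) (f : ℝ → ℂ) : ℝ≥0∞ :=
  (limsup (fun l : ℝ =>
    ENNReal.ofReal ((2 * l)⁻¹) * ∫⁻ t in Set.Ioc (-l) l, ‖f t‖ₑ ^ p) atTop) ^ (1 / p)

/-- `f` is a function in `B^p(ℝ, ℂ)`: a measurable function that is a limit of trigonometric
polynomials in the Besicovitch seminorm. (Local `p`-integrability follows.) -/
def InB (p : ℝ) (f : ℝ → ℂ) : Prop :=
  AEStronglyMeasurable f volume ∧
    ∀ ε : ℝ≥0∞, 0 < ε → ∃ P : ℝ → ℂ, IsTrigPolynomial P ∧ seminorm p (fun t => f t - P t) < ε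

/-- `f` and `g` represent the same element of the space `B(ℝ, ℂ) = B¹(ℝ, ℂ)`. -/
def SameClass (f g : ℝ → ℂ) : Prop :=
  seminorm 1 (fun t => f t - g t) = 0

/-- The class in `B(ℝ, ℂ)` represented by `f` belongs to the subspace `B²(ℝ, ℂ)`,
that is, it has a representative which is a function in `B²(ℝ, ℂ)`. -/
def ClassInB2 (f : ℝ → ℂ) : Prop :=
  ∃ g : ℝ → ℂ, InB 2 g ∧ SameClass f g

/-- The mean value `M(f) = lim_{l → ∞} (2l)⁻¹ ∫_{-l}^{l} f(t) dt` exists and equals `m`. -/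
def HasMean (f : ℝ → ℂ) (m : ℂ) : Prop :=
  Tendsto (fun l : ℝ => (((2 * l)⁻¹ : ℝ) : ℂ) * ∫ t in (-l)..l, f t) atTop (𝓝 m)

/-- The Fourier coefficient `a(f, x) = M(f(t) e^{-i x t})` exists and equals `m`. -/
def HasFourierCoeff (f : ℝ → ℂ) (x : ℝ) (m : ℂ) : Prop :=
  HasMean (fun t => f t * Complex.exp (-(Complex.I * (x : ℂ) * (t : ℂ)))) m

/-- Indices `j = 0, 1, 2, …` of a finite (`N < ∞`) or infinite (`N = ∞`) sequence of
length `N`. A countable set of exponents with `N` elements is given by an injective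
`freq : Index N → ℝ`. -/
abbrev Index (N : ℕ∞) : Type := {j : ℕ // (j : ℕ∞) < N}

/-- `∑_j a_j e^{i λ_j t}` is the Fourier series of `f`: the Fourier coefficient of `f` at `λ_j`
is `a_j`, and it vanishes at every real number which is not one of the `λ_j`.
(The exponents are meant to be distinct; some of the `a_j` may be zero.) -/
def HasFourierSeries {N : ℕ∞} (f : ℝ → ℂ) (freq : Index N → ℝ) (a : Index N → ℂ) : Prop :=
  (∀ j, HasFourierCoeff f (freq j) (a j)) ∧
    ∀ x : ℝ, x ∉ Set.range freq → HasFourierCoeff f x 0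

/-- Bohr equivalence of the formal series `∑ a_j e^{i λ_j t}` and `∑ b_j e^{i λ_j t}`:
for each `n` with `1 ≤ n ≤ N` there is a `ℚ`-linear map `ψ_n : V_n → ℝ`, where `V_n` is the
`ℚ`-span of the first `n` exponents, such that `b_j = a_j e^{i ψ_n(λ_j)}` for the first `n`
indices `j`. -/
def SeriesEquiv {N : ℕ∞} (freq : Index N → ℝ) (a b : Index N → ℂ) : Prop :=
  ∀ n : ℕ, 1 ≤ n → (n : ℕ∞) ≤ N →
    ∃ ψ : Submodule.span ℚ (freq '' {j | j.1 < n}) →ₗ[ℚ] ℝ,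
      ∀ (j : Index N) (hj : j.1 < n),
        b j = a j * Complex.exp (Complex.I *
          (ψ ⟨freq j, Submodule.subset_span (Set.mem_image_of_mem freq hj)⟩ : ℝ))

/-- Equivalence of two functions in `B(ℝ, ℂ)`: over a common countable set of exponents, their
Fourier series are Bohr equivalent. It depends only on the classes represented by the
functions, since the Fourier coefficients do. -/
def FunEquiv (f₁ f₂ : ℝ → ℂ) : Prop :=
  InB 1 f₁ ∧ InB 1 f₂ ∧
    ∃ (N : ℕ∞) (freq : Index N → ℝ) (a b : Index N → ℂ),
      Function.Injective freq ∧ HasFourierSeries f₁ freq a ∧ HasFourierSeries f₂ freq b ∧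
        SeriesEquiv freq a b

end Besicovitch

end

open scoped ComplexConjugate

noncomputable section

namespace Besicovitch

/-! Each `ψ_n` is real-valued, so equivalent series have coefficients of equal modulus. Nothing else
about equivalence is needed: membership in `B²` is decided by square-summability of the
coefficients.

Bessel's inequality (`InB.exists_sum_normSq_le`) makes the coefficients of a `B²` function
square-summable, hence also those of any equivalent series. The Riesz–Fischer theorem
(`exists_inB_two`) then produces a `B²` function with the new coefficients, which is the first
claim. It rests on Marcinkiewicz's device (`exists_gluing`): partial sums placed on successive
shells of rapidly growing radius form one function that is a limit of them all.

For the second claim, a `B²` representative of the class of `f₁` has the same Fourier coefficients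
as `f₁`, so the first argument yields `h` in `B²` with the Fourier series of `f₂`. Uniqueness in
`B¹` (`InB.seminorm_eq_zero`) shows that `f₂ - h` is null. There, vanishing coefficients give `M(f
Q) = 0` for every trigonometric polynomial `Q`; taking `Q` bounded and close to the conjugate sign
of a polynomial near `f` forces the mean of `|f|` to vanish. -/

/-! ### Averages over `(-l, l]` -/

/-- The average of `|f|^p` over `(-l, l]`. -/
def avgPow (p : ℝ) (f : ℝ → ℂ) (l : ℝ) : ℝ≥0∞ :=
  ENNReal.ofReal ((2 * l)⁻¹) * ∫⁻ t in Set.Ioc (-l) l, ‖f t‖ₑ ^ p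

/-- This lemma and the next are the only access to the limsup; all later estimates concern averages
for large `l`. -/
theorem eventually_avgPow_lt {p : ℝ} (hp : 0 < p) {f : ℝ → ℂ} {ε : ℝ≥0∞}
    (h : seminorm p f < ε) : ∀ᶠ l in atTop, avgPow p f l < ε ^ p := by
  have h1 : limsup (avgPow p f) atTop < ε ^ p := by
    have := ENNReal.rpow_lt_rpow h hp
    rwa [seminorm, ← ENNReal.rpow_mul, one_div, inv_mul_cancel₀ hp.ne', ENNReal.rpow_one] at this
  exact eventually_lt_of_limsup_lt h1

theorem seminorm_le {p : ℝ} (hp : 0 < p) {f : ℝ → ℂ} {ε : ℝ≥0∞}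
    (h : ∀ᶠ l in atTop, avgPow p f l ≤ ε ^ p) : seminorm p f ≤ ε := by
  have h1 : limsup (avgPow p f) atTop ≤ ε ^ p := limsup_le_of_le (by isBoundedDefault) h
  have := ENNReal.rpow_le_rpow h1 (one_div_pos.2 hp).le
  rwa [← ENNReal.rpow_mul, one_div, mul_inv_cancel₀ hp.ne', ENNReal.rpow_one, ← one_div] at this

/-- The normalised measure on `(-l, l]` has mass one, so its `L¹` norm is at most its `L²` norm. -/
theorem avgPow_one_sq_le {f : ℝ → ℂ} (hf : AEStronglyMeasurable f volume) {l : ℝ} (hl : 0 < l) :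
    avgPow 1 f l ^ (2 : ℝ) ≤ avgPow 2 f l := by
  set μ : Measure ℝ := ENNReal.ofReal ((2 * l)⁻¹) • volume.restrict (Set.Ioc (-l) l) with hμ
  have hprob : IsProbabilityMeasure μ := ⟨by
    rw [hμ, Measure.smul_apply, Measure.restrict_apply_univ, Real.volume_Ioc, smul_eq_mul,
      ← ENNReal.ofReal_mul (by positivity), ← ENNReal.ofReal_one]
    congr 1
    field_simp
    ring⟩
  have key := eLpNorm_le_eLpNorm_of_exponent_le (p := 1) (q := 2) (μ := μ) (f := f)
    (by norm_num) ((hf.restrict).smul_measure _)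
  have h2 : eLpNorm f 2 μ = (avgPow 2 f l) ^ (1 / (2 : ℝ)) := by
    rw [eLpNorm_eq_lintegral_rpow_enorm_toReal (by norm_num) (by norm_num), hμ,
      lintegral_smul_measure]
    simp [avgPow]
  have h1 : eLpNorm f 1 μ = avgPow 1 f l := by
    rw [eLpNorm_one_eq_lintegral_enorm, hμ, lintegral_smul_measure]
    simp [avgPow]
  rw [h1, h2] at key
  calc _ ≤ ((avgPow 2 f l) ^ (1 / (2 : ℝ))) ^ (2 : ℝ) := ENNReal.rpow_le_rpow key (by norm_num)
    _ = _ := by rw [← ENNReal.rpow_mul]; norm_num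

theorem seminorm_one_le_seminorm_two {f : ℝ → ℂ} (hf : AEStronglyMeasurable f volume) :
    seminorm 1 f ≤ seminorm 2 f := by
  refine le_of_forall_gt fun ε hε => ?_
  obtain ⟨δ, h1, h2⟩ := exists_between hε
  refine (seminorm_le one_pos ?_).trans_lt h2
  filter_upwards [eventually_avgPow_lt two_pos h1, eventually_gt_atTop 0] with l hl hl0
  rw [ENNReal.rpow_one]
  exact (ENNReal.rpow_le_rpow_iff (two_pos)).1 ((avgPow_one_sq_le hf hl0).trans hl.le)

theorem avgPow_one_add_le {f g : ℝ → ℂ} (hf : AEStronglyMeasurable f volume) (l : ℝ) :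
    avgPow 1 (fun t => f t + g t) l ≤ avgPow 1 f l + avgPow 1 g l := by
  simp only [avgPow, ENNReal.rpow_one]
  rw [← mul_add, ← lintegral_add_left' hf.restrict.enorm]
  gcongr
  exact enorm_add_le _ _

theorem avgPow_congr_norm {p : ℝ} {f g : ℝ → ℂ} (h : ∀ t, ‖f t‖ = ‖g t‖) (l : ℝ) :
    avgPow p f l = avgPow p g l := by
  have h' : ∀ t, ‖f t‖ₑ = ‖g t‖ₑ := fun t => by rw [← ofReal_norm, ← ofReal_norm, h]
  simp only [avgPow, h']

theorem avgPow_one_eq_ofReal {f : ℝ → ℂ} {l : ℝ} (hl : 0 ≤ l)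
    (hf : IntervalIntegrable f volume (-l) l) :
    avgPow 1 f l = ENNReal.ofReal ((2 * l)⁻¹ * ∫ t in (-l)..l, ‖f t‖) := by
  have hl' : -l ≤ l := by linarith
  rw [avgPow, ENNReal.ofReal_mul (by positivity), intervalIntegral.integral_of_le hl',
    ofReal_integral_norm_eq_lintegral_enorm ((intervalIntegrable_iff_integrableOn_Ioc_of_le hl').1 hf)]
  simp

theorem avgPow_two_eq_ofReal {f : ℝ → ℂ} {l : ℝ} (hl : 0 ≤ l)
    (hf : IntervalIntegrable (fun t => ‖f t‖ ^ 2) volume (-l) l) :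
    avgPow 2 f l = ENNReal.ofReal ((2 * l)⁻¹ * ∫ t in (-l)..l, ‖f t‖ ^ 2) := by
  have hl' : -l ≤ l := by linarith
  rw [avgPow, ENNReal.ofReal_mul (by positivity), intervalIntegral.integral_of_le hl',
    ofReal_integral_eq_lintegral_ofReal
      ((intervalIntegrable_iff_integrableOn_Ioc_of_le hl').1 hf) (ae_of_all _ fun _ => by positivity)]
  congr 2
  ext t
  rw [ENNReal.ofReal_pow (norm_nonneg _), ofReal_norm]
  norm_num

theorem norm_avg_le {f : ℝ → ℂ} {l : ℝ} (hl : 0 ≤ l) :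
    ‖(((2 * l)⁻¹ : ℝ) : ℂ) * ∫ t in (-l)..l, f t‖ ≤ (2 * l)⁻¹ * ∫ t in (-l)..l, ‖f t‖ := by
  rw [norm_mul, Complex.norm_real, Real.norm_of_nonneg (by positivity)]
  gcongr
  exact intervalIntegral.norm_integral_le_integral_norm (by linarith)

/-- Integrability on all intervals centred at the origin. -/
def CenteredIntegrable (f : ℝ → ℂ) : Prop :=
  ∀ l : ℝ, IntervalIntegrable f volume (-l) l

theorem CenteredIntegrable.of_eventually {f : ℝ → ℂ}
    (h : ∀ᶠ l in atTop, IntervalIntegrable f volume (-l) l) : CenteredIntegrable f := by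
  intro l
  obtain ⟨L, hL, hl⟩ := (h.and (eventually_ge_atTop |l|)).exists
  refine hL.mono_set (Set.uIcc_subset_uIcc ?_ ?_) <;>
  · rw [Set.mem_uIcc]
    have := abs_le.1 hl
    left
    constructor <;> linarith

theorem _root_.Continuous.centeredIntegrable {f : ℝ → ℂ} (hf : Continuous f) :
    CenteredIntegrable f := fun _ => hf.intervalIntegrable _ _

theorem CenteredIntegrable.add {f g : ℝ → ℂ} (hf : CenteredIntegrable f)
    (hg : CenteredIntegrable g) : CenteredIntegrable (fun t => f t + g t) :=
  fun l => (hf l).add (hg l)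

theorem CenteredIntegrable.sub {f g : ℝ → ℂ} (hf : CenteredIntegrable f)
    (hg : CenteredIntegrable g) : CenteredIntegrable (fun t => f t - g t) :=
  fun l => (hf l).sub (hg l)

theorem CenteredIntegrable.mul_continuous {f g : ℝ → ℂ} (hf : CenteredIntegrable f)
    (hg : Continuous g) : CenteredIntegrable (fun t => f t * g t) :=
  fun l => (hf l).mul_continuousOn hg.continuousOn

theorem lintegral_lt_top_of_avgPow_lt_top {p : ℝ} {f : ℝ → ℂ} {l : ℝ} (hl : 0 < l)
    (h : avgPow p f l < ∞) : ∫⁻ t in Set.Ioc (-l) l, ‖f t‖ₑ ^ p < ∞ := by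
  rw [avgPow] at h
  rcases ENNReal.mul_lt_top_iff.1 h with h | h | h
  · exact h.2
  · rw [ENNReal.ofReal_eq_zero] at h
    have : 0 < (2 * l)⁻¹ := by positivity
    linarith
  · simp [h]

theorem centeredIntegrable_of_seminorm_lt_top {f : ℝ → ℂ} (hf : AEStronglyMeasurable f volume)
    (h : seminorm 1 f < ∞) : CenteredIntegrable f := by
  refine .of_eventually ?_
  filter_upwards [eventually_avgPow_lt one_pos h, eventually_gt_atTop 0] with l hl hl0
  rw [intervalIntegrable_iff_integrableOn_Ioc_of_le (by linarith)]
  refine ⟨hf.restrict, ?_⟩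
  simpa [HasFiniteIntegral] using
    lintegral_lt_top_of_avgPow_lt_top hl0 (hl.trans_le le_top)

/-! ### Mean values -/

theorem HasMean.const_mul {f : ℝ → ℂ} {m : ℂ} (h : HasMean f m) (c : ℂ) :
    HasMean (fun t => c * f t) (c * m) := by
  unfold HasMean at *
  simp only [intervalIntegral.integral_const_mul]
  convert Tendsto.const_mul c h using 2
  ring

theorem HasMean.sub {f g : ℝ → ℂ} {m n : ℂ} (hf : CenteredIntegrable f)
    (hg : CenteredIntegrable g) (h : HasMean f m) (h' : HasMean g n) :
    HasMean (fun t => f t - g t) (m - n) := by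
  unfold HasMean at *
  convert Tendsto.sub h h' using 2 with l
  rw [intervalIntegral.integral_sub (hf l) (hg l)]
  ring

theorem HasMean.sum {ι : Type*} (s : Finset ι) {f : ι → ℝ → ℂ} {m : ι → ℂ}
    (hf : ∀ i ∈ s, CenteredIntegrable (f i)) (h : ∀ i ∈ s, HasMean (f i) (m i)) :
    HasMean (fun t => ∑ i ∈ s, f i t) (∑ i ∈ s, m i) := by
  unfold HasMean
  have := tendsto_finsetSum s h
  refine this.congr fun l => ?_
  rw [intervalIntegral.integral_finsetSum fun i hi => hf i hi l, Finset.mul_sum]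

theorem norm_exp_I_mul_mul (x t : ℝ) : ‖Complex.exp (Complex.I * (x : ℂ) * (t : ℂ))‖ = 1 := by
  rw [mul_assoc, ← Complex.ofReal_mul, mul_comm, Complex.norm_exp_ofReal_mul_I]

theorem hasMean_exp (x : ℝ) :
    HasMean (fun t => Complex.exp (Complex.I * (x : ℂ) * (t : ℂ))) (if x = 0 then 1 else 0) := by
  unfold HasMean
  split_ifs with hx
  · refine tendsto_const_nhds.congr' ?_
    filter_upwards [eventually_gt_atTop 0] with l hl
    simp only [hx, Complex.ofReal_zero, mul_zero, zero_mul, Complex.exp_zero,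
      intervalIntegral.integral_const, sub_neg_eq_add, Complex.real_smul, mul_one]
    rw [← Complex.ofReal_mul, ← two_mul, inv_mul_cancel₀ (by positivity), Complex.ofReal_one]
  · have hc : Complex.I * (x : ℂ) ≠ 0 := by simp [hx]
    rw [tendsto_zero_iff_norm_tendsto_zero]
    -- The integral of a nonconstant character is at most `2 / |x|` for every `l > 0`, so division
    -- by `2 * l` sends it to zero.
    have hlim : Tendsto (fun l : ℝ => (2 * l)⁻¹ * (2 / |x|)) atTop (𝓝 0) := by
      rw [← zero_mul (2 / |x|)]
      exact (tendsto_inv_atTop_zero.comp (tendsto_id.const_mul_atTop two_pos)).mul_const _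
    refine squeeze_zero' (Eventually.of_forall fun _ => norm_nonneg _) ?_ hlim
    filter_upwards [eventually_gt_atTop 0] with l hl
    rw [norm_mul, Complex.norm_real, Real.norm_of_nonneg (by positivity),
      integral_exp_mul_complex hc, norm_div, norm_mul, Complex.norm_I, one_mul, Complex.norm_real,
      Real.norm_eq_abs]
    gcongr
    refine (norm_sub_le _ _).trans ?_
    rw [norm_exp_I_mul_mul, norm_exp_I_mul_mul]
    norm_num

/-- A function that is approximated in the Besicovitch seminorm by functions whose means tend
to `m` has mean `m`. -/
theorem hasMean_of_approx {f : ℝ → ℂ} {m : ℂ} (hf : AEStronglyMeasurable f volume)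
    (h : ∀ ε : ℝ, 0 < ε → ∃ (g : ℝ → ℂ) (n : ℂ), CenteredIntegrable g ∧
      AEStronglyMeasurable g volume ∧ HasMean g n ∧ ‖n - m‖ ≤ ε ∧
      ∀ᶠ l in atTop, avgPow 1 (fun t => f t - g t) l ≤ ENNReal.ofReal ε) :
    HasMean f m := by
  refine Metric.tendsto_nhds.2 fun ε hε => ?_
  obtain ⟨g, n, hg, hgm, hn, hnm, hfg⟩ := h (ε / 4) (by positivity)
  have hn' := Metric.tendsto_nhds.1 hn (ε / 4) (by positivity)
  filter_upwards [hfg, hn', eventually_gt_atTop 0] with l h1 h2 hl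
  have hint : IntervalIntegrable (fun t => f t - g t) volume (-l) l := by
    rw [intervalIntegrable_iff_integrableOn_Ioc_of_le (by linarith)]
    refine ⟨(hf.sub hgm).restrict, ?_⟩
    simpa [HasFiniteIntegral] using
      lintegral_lt_top_of_avgPow_lt_top hl (h1.trans_lt ENNReal.ofReal_lt_top)
  rw [avgPow_one_eq_ofReal hl.le hint, ENNReal.ofReal_le_ofReal_iff (by positivity)] at h1
  have h3 := (norm_avg_le (f := fun t => f t - g t) hl.le).trans h1
  have h4 : (((2 * l)⁻¹ : ℝ) : ℂ) * ∫ t in (-l)..l, f t =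
      (((2 * l)⁻¹ : ℝ) : ℂ) * (∫ t in (-l)..l, (f t - g t)) +
      (((2 * l)⁻¹ : ℝ) : ℂ) * ∫ t in (-l)..l, g t := by
    rw [← mul_add, ← intervalIntegral.integral_add hint (hg l)]
    simp
  rw [h4]
  rw [dist_eq_norm] at h2 ⊢
  calc _ = ‖(((2 * l)⁻¹ : ℝ) : ℂ) * (∫ t in (-l)..l, (f t - g t)) +
        ((((2 * l)⁻¹ : ℝ) : ℂ) * (∫ t in (-l)..l, g t) - n) + (n - m)‖ := by congr 1; ring
    _ ≤ ε / 4 + ε / 4 + ε / 4 := (norm_add₃_le).trans (by gcongr)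
    _ < ε := by linarith

/-- Multiplication by a character preserves moduli, hence the averages of the difference. -/
theorem hasFourierCoeff_of_approx {f : ℝ → ℂ} {x : ℝ} {m : ℂ}
    (hf : AEStronglyMeasurable f volume)
    (h : ∀ ε : ℝ, 0 < ε → ∃ (g : ℝ → ℂ) (n : ℂ), CenteredIntegrable g ∧
      AEStronglyMeasurable g volume ∧ HasFourierCoeff g x n ∧ ‖n - m‖ ≤ ε ∧
      ∀ᶠ l in atTop, avgPow 1 (fun t => f t - g t) l ≤ ENNReal.ofReal ε) :
    HasFourierCoeff f x m := by
  have hc : Continuous fun t : ℝ => Complex.exp (-(Complex.I * (x : ℂ) * (t : ℂ))) := by fun_prop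
  refine hasMean_of_approx (hf.mul hc.aestronglyMeasurable) fun ε hε => ?_
  obtain ⟨g, n, h1, h2, h3, h4, h5⟩ := h ε hε
  refine ⟨_, n, h1.mul_continuous hc, h2.mul hc.aestronglyMeasurable, h3, h4, ?_⟩
  filter_upwards [h5] with l hl
  refine le_of_eq_of_le (avgPow_congr_norm (fun t => ?_) l) hl
  rw [← sub_mul, norm_mul, Complex.exp_neg, norm_inv, norm_exp_I_mul_mul, inv_one, mul_one]

/-! ### Trigonometric polynomials -/

/-- The trigonometric polynomial with coefficients `c` on the finite spectrum `s`. -/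
def trigSum (s : Finset ℝ) (c : ℝ → ℂ) (t : ℝ) : ℂ :=
  ∑ x ∈ s, c x * Complex.exp (Complex.I * (x : ℂ) * (t : ℂ))

theorem isTrigPolynomial_trigSum (s : Finset ℝ) (c : ℝ → ℂ) : IsTrigPolynomial (trigSum s c) :=
  ⟨s, c, fun _ => rfl⟩

theorem IsTrigPolynomial.continuous {P : ℝ → ℂ} (hP : IsTrigPolynomial P) : Continuous P := by
  obtain ⟨s, c, h⟩ := hP
  rw [funext h]
  fun_prop

theorem IsTrigPolynomial.exists_norm_le {P : ℝ → ℂ} (hP : IsTrigPolynomial P) :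
    ∃ R : ℝ, ∀ t, ‖P t‖ ≤ R := by
  obtain ⟨s, c, h⟩ := hP
  refine ⟨∑ x ∈ s, ‖c x‖, fun t => ?_⟩
  rw [h]
  refine (norm_sum_le _ _).trans_eq (Finset.sum_congr rfl fun x _ => ?_)
  rw [norm_mul, norm_exp_I_mul_mul, mul_one]

theorem isTrigPolynomial_monomial (c : ℂ) (x : ℝ) :
    IsTrigPolynomial fun t => c * Complex.exp (Complex.I * (x : ℂ) * (t : ℂ)) :=
  ⟨{x}, fun _ => c, fun t => by simp⟩

theorem isTrigPolynomial_const (c : ℂ) : IsTrigPolynomial fun _ => c := by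
  simpa using isTrigPolynomial_monomial c 0

theorem IsTrigPolynomial.add {P Q : ℝ → ℂ} (hP : IsTrigPolynomial P) (hQ : IsTrigPolynomial Q) :
    IsTrigPolynomial fun t => P t + Q t := by
  classical
  obtain ⟨s, c, h⟩ := hP
  obtain ⟨s', c', h'⟩ := hQ
  refine ⟨s ∪ s', fun x => (if x ∈ s then c x else 0) + (if x ∈ s' then c' x else 0),
    fun t => ?_⟩
  simp only [h, h', add_mul, Finset.sum_add_distrib, ite_mul, zero_mul]
  simp only [Finset.sum_ite_mem, Finset.union_inter_cancel_left, Finset.union_inter_cancel_right]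

theorem IsTrigPolynomial.sum {ι : Type*} (s : Finset ι) {P : ι → ℝ → ℂ}
    (h : ∀ i ∈ s, IsTrigPolynomial (P i)) : IsTrigPolynomial fun t => ∑ i ∈ s, P i t := by
  classical
  induction s using Finset.induction_on with
  | empty => simpa using isTrigPolynomial_const 0
  | insert a s ha ih =>
    simp only [Finset.sum_insert ha]
    exact (h a (by simp)).add (ih fun i hi => h i (by simp [hi]))

theorem IsTrigPolynomial.mul {P Q : ℝ → ℂ} (hP : IsTrigPolynomial P) (hQ : IsTrigPolynomial Q) :
    IsTrigPolynomial fun t => P t * Q t := by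
  obtain ⟨s, c, h⟩ := hP
  obtain ⟨s', c', h'⟩ := hQ
  simp only [h, h', Finset.sum_mul_sum]
  refine .sum _ fun x _ => .sum _ fun y _ => ?_
  convert isTrigPolynomial_monomial (c x * c' y) (x + y) using 2 with t
  rw [mul_mul_mul_comm, ← Complex.exp_add]
  push_cast
  ring_nf

theorem conj_exp_I_mul_mul (x t : ℝ) : conj (Complex.exp (Complex.I * (x : ℂ) * (t : ℂ))) =
    Complex.exp (-(Complex.I * (x : ℂ) * (t : ℂ))) := by
  rw [← Complex.exp_conj]
  simp

theorem IsTrigPolynomial.conj {P : ℝ → ℂ} (hP : IsTrigPolynomial P) :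
    IsTrigPolynomial fun t => conj (P t) := by
  obtain ⟨s, c, h⟩ := hP
  simp only [h, map_sum, map_mul]
  refine .sum _ fun x _ => ?_
  convert isTrigPolynomial_monomial ((starRingEnd ℂ) (c x)) (-x) using 3 with t
  rw [conj_exp_I_mul_mul]
  simp

theorem IsTrigPolynomial.pow {P : ℝ → ℂ} (hP : IsTrigPolynomial P) (n : ℕ) :
    IsTrigPolynomial fun t => P t ^ n := by
  induction n with
  | zero => simpa using isTrigPolynomial_const 1
  | succ n ih => simpa only [pow_succ] using ih.mul hP

theorem IsTrigPolynomial.polynomial_eval {P : ℝ → ℂ} (hP : IsTrigPolynomial P)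
    (q : Polynomial ℂ) : IsTrigPolynomial fun t => q.eval (P t) := by
  simp only [Polynomial.eval_eq_sum_range]
  exact .sum _ fun i _ => (isTrigPolynomial_const _).mul (hP.pow i)

theorem hasFourierCoeff_exp (x y : ℝ) :
    HasFourierCoeff (fun t => Complex.exp (Complex.I * (x : ℂ) * (t : ℂ))) y
      (if x = y then 1 else 0) := by
  have := hasMean_exp (x - y)
  simp only [sub_eq_zero] at this
  unfold HasFourierCoeff
  convert this using 2 with t
  rw [← Complex.exp_add]
  push_cast
  ring_nf

theorem hasFourierCoeff_trigSum (s : Finset ℝ) (c : ℝ → ℂ) (y : ℝ) :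
    HasFourierCoeff (trigSum s c) y (if y ∈ s then c y else 0) := by
  have h := HasMean.sum s (f := fun x t => c x * (Complex.exp (Complex.I * (x : ℂ) * (t : ℂ)) *
      Complex.exp (-(Complex.I * (y : ℂ) * (t : ℂ))))) (m := fun x => c x * if x = y then 1 else 0)
    (fun x _ => Continuous.centeredIntegrable (by fun_prop))
    (fun x _ => (hasFourierCoeff_exp x y).const_mul (c x))
  unfold HasFourierCoeff
  convert h using 2 with t
  · simp only [trigSum, Finset.sum_mul, mul_assoc]
  · simp

/-- Pairing of a function with the conjugate of a trigonometric polynomial. -/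
theorem hasMean_mul_conj_trigSum {f : ℝ → ℂ} (hf : CenteredIntegrable f) {a : ℝ → ℂ}
    (s : Finset ℝ) (h : ∀ x ∈ s, HasFourierCoeff f x (a x)) (c : ℝ → ℂ) :
    HasMean (fun t => f t * conj (trigSum s c t)) (∑ x ∈ s, conj (c x) * a x) := by
  have h := HasMean.sum s (f := fun x t => conj (c x) * (f t *
      Complex.exp (-(Complex.I * (x : ℂ) * (t : ℂ))))) (m := fun x => conj (c x) * a x)
    (fun x _ => by
      convert hf.mul_continuous (g := fun t => conj (c x) *
        Complex.exp (-(Complex.I * (x : ℂ) * (t : ℂ)))) (by fun_prop) using 2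
      ring)
    (fun x hx => (h x hx).const_mul _)
  convert h using 2 with t
  simp only [trigSum, map_sum, map_mul, conj_exp_I_mul_mul, Finset.mul_sum]
  exact Finset.sum_congr rfl fun x _ => by ring

theorem hasMean_normSq_trigSum (s : Finset ℝ) (c : ℝ → ℂ) :
    HasMean (fun t => ((‖trigSum s c t‖ ^ 2 : ℝ) : ℂ)) ((∑ x ∈ s, ‖c x‖ ^ 2 : ℝ) : ℂ) := by
  have h := hasMean_mul_conj_trigSum (isTrigPolynomial_trigSum s c).continuous.centeredIntegrable
    (a := c) s (fun x hx => by simpa [hx] using hasFourierCoeff_trigSum s c x) c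
  convert h using 2 with t
  · simp [Complex.mul_conj']
  · push_cast
    exact Finset.sum_congr rfl fun x _ => by rw [Complex.conj_mul']

theorem HasMean.tendsto_re {f : ℝ → ℂ} {m : ℂ} (h : HasMean f m) (hf : CenteredIntegrable f) :
    Tendsto (fun l : ℝ => (2 * l)⁻¹ * ∫ t in (-l)..l, (f t).re) atTop (𝓝 m.re) := by
  have := (Complex.continuous_re.tendsto m).comp h
  refine this.congr fun l => ?_
  simp only [Function.comp_apply, Complex.re_ofReal_mul]
  congr 1
  exact (Complex.reCLM.intervalIntegral_comp_comm (hf l)).symm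

/-- Parseval for trigonometric polynomials; it controls the differences of partial sums in
Riesz–Fischer. -/
theorem tendsto_avgPow_two_trigSum (s : Finset ℝ) (c : ℝ → ℂ) :
    Tendsto (avgPow 2 (trigSum s c)) atTop (𝓝 (ENNReal.ofReal (∑ x ∈ s, ‖c x‖ ^ 2))) := by
  have hc := (isTrigPolynomial_trigSum s c).continuous
  have h := (hasMean_normSq_trigSum s c).tendsto_re
    (Continuous.centeredIntegrable (by fun_prop))
  simp only [Complex.ofReal_re] at h
  refine (ENNReal.tendsto_ofReal h).congr' ?_
  filter_upwards [eventually_ge_atTop 0] with l hl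
  exact (avgPow_two_eq_ofReal hl (Continuous.intervalIntegrable (by fun_prop) _ _)).symm

/-! ### Elements of `B^p` -/

theorem InB.one_of_two {f : ℝ → ℂ} (hf : InB 2 f) : InB 1 f :=
  ⟨hf.1, fun ε hε => by
    obtain ⟨P, hP, h⟩ := hf.2 ε hε
    exact ⟨P, hP, (seminorm_one_le_seminorm_two
      (hf.1.sub hP.continuous.aestronglyMeasurable)).trans_lt h⟩⟩

theorem InB.centeredIntegrable {f : ℝ → ℂ} (hf : InB 1 f) : CenteredIntegrable f := by
  obtain ⟨P, hP, h⟩ := hf.2 1 one_pos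
  have h1 := centeredIntegrable_of_seminorm_lt_top
    (hf.1.sub hP.continuous.aestronglyMeasurable) (h.trans_le le_top)
  simpa using h1.add hP.continuous.centeredIntegrable

theorem InB.exists_avgPow_two_le {f : ℝ → ℂ} (hf : InB 2 f) :
    ∃ C : ℝ, ∀ᶠ l in atTop, avgPow 2 f l ≤ ENNReal.ofReal C := by
  obtain ⟨P, hP, h⟩ := hf.2 1 one_pos
  obtain ⟨R, hR⟩ := hP.exists_norm_le
  -- From `|f|² ≤ 2 (|f - P|² + R²)`, where the mean square of `f - P` is eventually below 1.
  refine ⟨2 * (1 + R ^ 2), ?_⟩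
  filter_upwards [eventually_avgPow_lt two_pos h, eventually_gt_atTop 0] with l hl hl0
  have hpt : ∀ t, ‖f t‖ₑ ^ (2 : ℝ) ≤
      2 * (‖f t - P t‖ₑ ^ (2 : ℝ) + ENNReal.ofReal (R ^ 2)) := fun t => by
    have h1 : ‖f t‖ ^ 2 ≤ 2 * (‖f t - P t‖ ^ 2 + R ^ 2) := by
      have h2 : ‖f t‖ ≤ ‖f t - P t‖ + R := by
        calc ‖f t‖ = ‖(f t - P t) + P t‖ := by simp
          _ ≤ _ := (norm_add_le _ _).trans (by gcongr; exact hR t)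
      nlinarith [sq_nonneg (‖f t - P t‖ - R), norm_nonneg (f t)]
    have := ENNReal.ofReal_le_ofReal h1
    rw [ENNReal.ofReal_mul two_pos.le, ENNReal.ofReal_add (by positivity) (by positivity),
      ENNReal.ofReal_pow (norm_nonneg _), ENNReal.ofReal_pow (norm_nonneg _), ofReal_norm,
      ofReal_norm] at this
    simpa using this
  calc avgPow 2 f l ≤ ENNReal.ofReal ((2 * l)⁻¹) * ∫⁻ t in Set.Ioc (-l) l,
        2 * (‖f t - P t‖ₑ ^ (2 : ℝ) + ENNReal.ofReal (R ^ 2)) := by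
        unfold avgPow; gcongr with t; exact hpt t
    _ = 2 * (avgPow 2 (fun t => f t - P t) l + ENNReal.ofReal ((2 * l)⁻¹) *
        (ENNReal.ofReal (R ^ 2) * ENNReal.ofReal (2 * l))) := by
        rw [lintegral_const_mul' _ _ (by norm_num), lintegral_add_right _ measurable_const,
          lintegral_const, Measure.restrict_apply_univ, Real.volume_Ioc, avgPow, sub_neg_eq_add,
          ← two_mul]
        ring
    _ ≤ 2 * (1 + ENNReal.ofReal (R ^ 2)) := by
        gcongr
        · simpa using hl.le
        · rw [mul_left_comm, ← ENNReal.ofReal_mul (by positivity), inv_mul_cancel₀ (by positivity)]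
          simp
    _ = _ := by
        rw [ENNReal.ofReal_mul two_pos.le, ENNReal.ofReal_add one_pos.le (by positivity)]
        simp

/-- **Bessel's inequality** in `B²`. -/
theorem InB.exists_sum_normSq_le {f : ℝ → ℂ} (hf : InB 2 f) {a : ℝ → ℂ}
    (h : ∀ x, HasFourierCoeff f x (a x)) :
    ∃ C : ℝ, ∀ s : Finset ℝ, ∑ x ∈ s, ‖a x‖ ^ 2 ≤ C := by
  obtain ⟨C, hC⟩ := hf.exists_avgPow_two_le
  refine ⟨max C 0, fun s => ?_⟩
  have hfi := hf.one_of_two.centeredIntegrable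
  have hc := (isTrigPolynomial_trigSum s a).continuous
  have hc' : Continuous fun t => conj (trigSum s a t) := Complex.continuous_conj.comp hc
  have h1 := (hasMean_mul_conj_trigSum hfi s (fun x _ => h x) a).tendsto_re
    (hfi.mul_continuous hc')
  have h2 := (hasMean_normSq_trigSum s a).tendsto_re
    (Continuous.centeredIntegrable (by fun_prop))
  have hsum : (∑ x ∈ s, conj (a x) * a x).re = ∑ x ∈ s, ‖a x‖ ^ 2 := by
    simp only [Complex.conj_mul', ← Complex.ofReal_pow, ← Complex.ofReal_sum, Complex.ofReal_re]
  rw [hsum] at h1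
  simp only [Complex.ofReal_re] at h2
  -- With `S` the partial sum, `|f - S|² ≥ 0` reads `2 Re(f conj S) - |S|² ≤ |f|²`; the mean of the
  -- left side is the sum of squares.
  have h3 := (h1.const_mul 2).sub h2
  have h4 : 2 * ∑ x ∈ s, ‖a x‖ ^ 2 - ∑ x ∈ s, ‖a x‖ ^ 2 = ∑ x ∈ s, ‖a x‖ ^ 2 := by ring
  rw [h4] at h3
  refine le_of_tendsto h3 ?_
  filter_upwards [hC, eventually_gt_atTop 0] with l hl hl0
  have hle : -l ≤ l := by linarith
  have hsq : IntervalIntegrable (fun t => ‖f t‖ ^ 2) volume (-l) l := by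
    rw [intervalIntegrable_iff_integrableOn_Ioc_of_le hle]
    refine ⟨(hf.1.norm.pow 2).restrict, ?_⟩
    have := lintegral_lt_top_of_avgPow_lt_top hl0 (hl.trans_lt ENNReal.ofReal_lt_top)
    simpa [HasFiniteIntegral] using this
  have hre : IntervalIntegrable (fun t => (f t * conj (trigSum s a t)).re) volume (-l) l := by
    rw [intervalIntegrable_iff_integrableOn_Ioc_of_le hle]
    exact ((intervalIntegrable_iff_integrableOn_Ioc_of_le hle).1
      (hfi.mul_continuous hc' l)).re
  have hS : IntervalIntegrable (fun t => ‖trigSum s a t‖ ^ 2) volume (-l) l :=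
    Continuous.intervalIntegrable (by fun_prop) _ _
  rw [avgPow_two_eq_ofReal hl0.le hsq] at hl
  have h5 : (2 * l)⁻¹ * ∫ t in (-l)..l, ‖f t‖ ^ 2 ≤ max C 0 :=
    (ENNReal.ofReal_le_ofReal_iff (le_max_right C 0)).1
      (hl.trans (ENNReal.ofReal_le_ofReal (le_max_left C 0)))
  refine le_trans ?_ h5
  rw [mul_left_comm, ← mul_sub]
  gcongr
  rw [← intervalIntegral.integral_const_mul, ← intervalIntegral.integral_sub (hre.const_mul 2) hS]
  refine intervalIntegral.integral_mono_on hle ((hre.const_mul 2).sub hS) hsq fun t _ => ?_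
  have h6 := Complex.normSq_nonneg (f t - trigSum s a t)
  rw [Complex.normSq_sub] at h6
  simp only [Complex.normSq_eq_norm_sq] at h6
  linarith

/-! ### Marcinkiewicz's gluing construction -/

/-- Doubling the scales keeps the errors accumulated on earlier shells comparable to the last scale.
-/
theorem exists_scale {p : ℕ → ℝ → Prop} (h : ∀ k, ∀ᶠ l in atTop, p k l) :
    ∃ T : ℕ → ℝ, 1 ≤ T 0 ∧ (∀ k, 2 * T k ≤ T (k + 1)) ∧ ∀ k, ∀ l, T k ≤ l → p k l := by
  choose A hA using fun k => eventually_atTop.1 (h k)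
  let T : ℕ → ℝ := fun k => Nat.rec (max 1 (A 0)) (fun k t => max (2 * t) (A (k + 1))) k
  refine ⟨T, le_max_left _ _, fun k => le_max_left _ _, fun k l hl => hA k l ?_⟩
  cases k with
  | zero => exact (le_max_right _ _).trans hl
  | succ k => exact (le_max_right _ _).trans hl

/-- If `S` is a sequence of continuous functions such that the mean squares of `S k - S m` over
`(-l, l]`, `k ≥ m`, are eventually at most `ε m / 2`, then `S m` is close, in mean square, to some
measurable function that does not depend on `m`. -/
theorem exists_gluing {S : ℕ → ℝ → ℂ} (hS : ∀ k, Continuous (S k)) {ε : ℕ → ℝ}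
    (hε : ∀ m, 0 < ε m)
    (h : ∀ m k, m ≤ k → ∀ᶠ l in atTop,
      ∫⁻ t in Set.Ioc (-l) l, ‖S k t - S m t‖ₑ ^ (2 : ℝ) ≤ ENNReal.ofReal (l * ε m)) :
    ∃ f : ℝ → ℂ, Measurable f ∧ ∀ m, ∀ᶠ l in atTop,
      avgPow 2 (fun t => f t - S m t) l ≤ ENNReal.ofReal (2 * ε m) := by
  classical
  obtain ⟨T, hT0, hT2, hT⟩ := exists_scale (p := fun k l => ∀ m ∈ Finset.range (k + 1),
    ∫⁻ t in Set.Ioc (-l) l, ‖S k t - S m t‖ₑ ^ (2 : ℝ) ≤ ENNReal.ofReal (l * ε m))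
    (fun k => (Finset.eventually_all _).2 fun m hm => h m k (by simp at hm; omega))
  have hT1 : ∀ k, (2 : ℝ) ^ k ≤ T k := fun k => by
    induction k with
    | zero => simpa using hT0
    | succ k ih => rw [pow_succ]; linarith [hT2 k]
  have hTpos : ∀ k, 0 < T k := fun k => (by positivity : (0 : ℝ) < 2 ^ k).trans_le (hT1 k)
  have hTmono : Monotone T := monotone_nat_of_le_succ fun k => by linarith [hT2 k, hTpos k]
  have hex : ∀ t : ℝ, ∃ k : ℕ, t ∈ Set.Ioc (-T (k + 1)) (T (k + 1)) := fun t => by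
    obtain ⟨k, hk⟩ := pow_unbounded_of_one_lt |t| one_lt_two
    have h1 := abs_lt.1 (hk.trans_le ((hT1 k).trans (hTmono k.le_succ)))
    exact ⟨k, h1.1, h1.2.le⟩
  -- The value is `S k` on the shell between radii `T k` and `T (k + 1)`, and `S 0` on the whole of
  -- `(-T 1, T 1]`.
  let f : ℝ → ℂ := fun t => S (Nat.find (hex t)) t
  refine ⟨f, Measurable.find (fun k => (hS k).measurable) (fun _ => measurableSet_Ioc) hex,
    fun m => ?_⟩
  let J : ℝ → ℝ≥0∞ := fun l => ∫⁻ t in Set.Ioc (-l) l, ‖f t - S m t‖ₑ ^ (2 : ℝ)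
  have hfind : ∀ {t : ℝ} {k : ℕ}, t ∈ Set.Ioc (-T (k + 1)) (T (k + 1)) →
      t ∉ Set.Ioc (-T k) (T k) → f t = S k t := fun {t k} h1 h2 => by
    have : Nat.find (hex t) = k := by
      rw [Nat.find_eq_iff]
      refine ⟨h1, fun n hn h3 => h2 ?_⟩
      have h4 : T (n + 1) ≤ T k := hTmono hn
      exact ⟨by linarith [h3.1], h3.2.trans h4⟩
    simp only [f, this]
  -- Inside radius `T m` only the continuous functions `S 0, …, S m` occur.
  have hJm : J (T m) < ∞ := by
    have hbound : ∀ t ∈ Set.Ioc (-T m) (T m), ‖f t - S m t‖ₑ ^ (2 : ℝ) ≤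
        ENNReal.ofReal (∑ i ∈ Finset.range (m + 1), ‖S i t - S m t‖ ^ 2) := fun t ht => by
      have hle : Nat.find (hex t) ≤ m := Nat.find_min' (hex t)
        ⟨by linarith [ht.1, hTmono m.le_succ], ht.2.trans (hTmono m.le_succ)⟩
      have := Finset.single_le_sum (f := fun i => ‖S i t - S m t‖ ^ 2)
        (s := Finset.range (m + 1)) (fun i _ => by positivity)
        (Finset.mem_range.2 (Nat.lt_succ_of_le hle))
      refine le_trans (le_of_eq ?_) (ENNReal.ofReal_le_ofReal this)
      rw [ENNReal.ofReal_pow (norm_nonneg _), ofReal_norm]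
      norm_num [f]
    refine (setLIntegral_mono' measurableSet_Ioc hbound).trans_lt ?_
    have hc : Continuous fun t => ∑ i ∈ Finset.range (m + 1), ‖S i t - S m t‖ ^ 2 := by
      have := hS
      fun_prop
    exact (hc.integrableOn_Ioc).lintegral_lt_top
  have hstep : ∀ k, m ≤ k → ∀ l, T k ≤ l → l ≤ T (k + 1) →
      J l ≤ J (T k) + ENNReal.ofReal (l * ε m) := fun k hk l hl hl' => by
    have hsub : Set.Ioc (-l) l = Set.Ioc (-T k) (T k) ∪
        (Set.Ioc (-l) l \ Set.Ioc (-T k) (T k)) := by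
      rw [Set.union_sdiff_cancel]
      exact Set.Ioc_subset_Ioc (by linarith) hl
    calc J l ≤ J (T k) + ∫⁻ t in Set.Ioc (-l) l \ Set.Ioc (-T k) (T k),
          ‖f t - S m t‖ₑ ^ (2 : ℝ) := by
          simp only [J]
          conv_lhs => rw [hsub]
          exact lintegral_union_le _ _ _
      _ = J (T k) + ∫⁻ t in Set.Ioc (-l) l \ Set.Ioc (-T k) (T k),
          ‖S k t - S m t‖ₑ ^ (2 : ℝ) := by
          congr 1
          refine setLIntegral_congr_fun (measurableSet_Ioc.diff measurableSet_Ioc) fun t ht => ?_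
          rw [hfind ⟨by linarith [ht.1.1], ht.1.2.trans hl'⟩ ht.2]
      _ ≤ J (T k) + ∫⁻ t in Set.Ioc (-l) l, ‖S k t - S m t‖ₑ ^ (2 : ℝ) := by
          gcongr
          exact Set.sdiff_subset
      _ ≤ _ := by
          gcongr
          exact hT k l hl m (by simp; omega)
  -- Doubling closes the induction: `2 T k + T (k + 1) ≤ 2 T (k + 1)`, and `2 T k + l ≤ 3 l` once `T
  -- k ≤ l`.
  have hind : ∀ k, m ≤ k → J (T k) ≤ J (T m) + ENNReal.ofReal (2 * T k * ε m) ∧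
      ∀ l, T m ≤ l → l ≤ T k → J l ≤ J (T m) + ENNReal.ofReal (3 * l * ε m) := by
    intro k hk
    induction k, hk using Nat.le_induction with
    | base => exact ⟨le_self_add, fun l h1 h2 => by rw [le_antisymm h2 h1]; exact le_self_add⟩
    | succ k hk ih =>
      have hnew : ∀ l, T k ≤ l → l ≤ T (k + 1) →
          J l ≤ J (T m) + ENNReal.ofReal (2 * T k * ε m + l * ε m) := fun l h1 h2 => by
        have hl : 0 < l := (hTpos k).trans_le h1
        have := hTpos k
        have := hε m
        rw [ENNReal.ofReal_add (by positivity) (by positivity), ← add_assoc]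
        exact (hstep k hk l h1 h2).trans (by gcongr; exact ih.1)
      refine ⟨(hnew _ (hTmono k.le_succ) le_rfl).trans ?_, fun l h1 h2 => ?_⟩
      · gcongr
        nlinarith [hT2 k, hε m]
      · rcases le_total l (T k) with h3 | h3
        · exact ih.2 l h1 h3
        · refine (hnew l h3 h2).trans ?_
          gcongr
          nlinarith [hε m]
  -- Past the second threshold the fixed amount `J (T m)` is at most `l * ε m`, giving `4 * l * ε m`
  -- in total and `2 * ε m` after division by `2 * l`.
  filter_upwards [eventually_ge_atTop (T m),
    eventually_ge_atTop ((J (T m)).toReal / ε m)] with l hl1 hl2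
  have hl : 0 < l := (hTpos m).trans_le hl1
  have := hε m
  obtain ⟨k, hk⟩ := pow_unbounded_of_one_lt l one_lt_two
  have hJl : J l ≤ ENNReal.ofReal (4 * l * ε m) := by
    refine ((hind (max m k) (le_max_left _ _)).2 l hl1
      (hk.le.trans ((hT1 k).trans (hTmono (le_max_right _ _))))).trans ?_
    rw [← ENNReal.ofReal_toReal hJm.ne, ← ENNReal.ofReal_add (by positivity) (by positivity)]
    gcongr
    rw [div_le_iff₀ this] at hl2
    linarith
  calc avgPow 2 (fun t => f t - S m t) l ≤
        ENNReal.ofReal ((2 * l)⁻¹) * ENNReal.ofReal (4 * l * ε m) := by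
        unfold avgPow; gcongr
    _ = _ := by
        rw [← ENNReal.ofReal_mul (by positivity)]
        congr 1
        field_simp
        ring

/-! ### The Riesz–Fischer theorem in `B²` -/

theorem trigSum_sub_trigSum {s s' : Finset ℝ} (h : s ⊆ s') (c : ℝ → ℂ) (t : ℝ) :
    trigSum s' c t - trigSum s c t = trigSum (s' \ s) c t := by
  rw [trigSum, trigSum, trigSum, ← Finset.sum_sdiff h, add_sub_cancel_right]

/-- **Riesz–Fischer theorem** in `B²`: every square-summable family of coefficients is the family
of Fourier coefficients of a function in `B²`. -/
theorem exists_inB_two {b : ℝ → ℂ} (hb : Summable fun x => ‖b x‖ ^ 2) :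
    ∃ h : ℝ → ℂ, InB 2 h ∧ ∀ x, HasFourierCoeff h x (b x) := by
  classical
  let e : ℕ → ℝ := fun m => 1 / ((m : ℝ) + 1)
  have he : ∀ m, 0 < e m := fun m => Nat.one_div_pos_of_nat
  choose F hF using fun m => summable_iff_vanishing_norm.1 hb (e m / 2) (half_pos (he m))
  -- The unions are nested and keep the tail bound, since `G m` contains `F m`.
  let G : ℕ → Finset ℝ := fun m => (Finset.range (m + 1)).biUnion F
  have hG : ∀ m s, Disjoint s (G m) → ∑ x ∈ s, ‖b x‖ ^ 2 < e m / 2 := fun m s hs =>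
    (Real.le_norm_self _).trans_lt (hF m s (hs.mono_right
      (Finset.subset_biUnion_of_mem F (Finset.self_mem_range_succ m))))
  have hGm : Monotone G := fun m k hmk =>
    Finset.biUnion_subset_biUnion_of_subset_left _ (by simpa using hmk)
  obtain ⟨f, hfm, hf⟩ := exists_gluing (S := fun m => trigSum (G m) b) (ε := e)
    (fun k => (isTrigPolynomial_trigSum _ _).continuous) he (fun m k hmk => by
      have h1 := (tendsto_avgPow_two_trigSum (G k \ G m) b).eventually_lt_const
        ((ENNReal.ofReal_lt_ofReal_iff (half_pos (he m))).2 (hG m _ Finset.sdiff_disjoint))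
      filter_upwards [h1, eventually_gt_atTop 0] with l hl hl0
      simp only [trigSum_sub_trigSum (hGm hmk)]
      calc ∫⁻ t in Set.Ioc (-l) l, ‖trigSum (G k \ G m) b t‖ₑ ^ (2 : ℝ)
          = ENNReal.ofReal (2 * l) * avgPow 2 (trigSum (G k \ G m) b) l := by
            rw [avgPow, ← mul_assoc, ← ENNReal.ofReal_mul (by positivity),
              mul_inv_cancel₀ (by positivity), ENNReal.ofReal_one, one_mul]
        _ ≤ ENNReal.ofReal (2 * l) * ENNReal.ofReal (e m / 2) := by gcongr
        _ = ENNReal.ofReal (l * e m) := by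
            rw [← ENNReal.ofReal_mul (by positivity)]
            congr 1
            ring)
  have hsmall : ∀ δ : ℝ, 0 < δ → ∃ m, 2 * e m ≤ δ ^ 2 := fun δ hδ => by
    obtain ⟨m, hm⟩ := exists_nat_one_div_lt (show 0 < δ ^ 2 / 2 by positivity)
    exact ⟨m, by linarith⟩
  have hsq : ∀ δ : ℝ, 0 < δ → ENNReal.ofReal δ ^ (2 : ℝ) = ENNReal.ofReal (δ ^ 2) :=
    fun δ hδ => by rw [ENNReal.ofReal_rpow_of_pos hδ, Real.rpow_two]
  refine ⟨f, ⟨hfm.aestronglyMeasurable, fun ε hε => ?_⟩, fun x => ?_⟩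
  · obtain ⟨δ, -, hδ0, hδ⟩ := ENNReal.lt_iff_exists_real_btwn.1 hε
    have hδ0' : 0 < δ := ENNReal.ofReal_pos.1 hδ0
    obtain ⟨m, hm⟩ := hsmall δ hδ0'
    refine ⟨_, isTrigPolynomial_trigSum (G m) b, (seminorm_le two_pos ?_).trans_lt hδ⟩
    filter_upwards [hf m] with l hl
    rw [hsq δ hδ0']
    exact hl.trans (ENNReal.ofReal_le_ofReal hm)
  · refine hasFourierCoeff_of_approx hfm.aestronglyMeasurable fun δ hδ => ?_
    obtain ⟨m, hm⟩ := hsmall δ hδ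
    have hc := (isTrigPolynomial_trigSum (G m) b).continuous
    refine ⟨_, _, hc.centeredIntegrable, hc.aestronglyMeasurable,
      hasFourierCoeff_trigSum (G m) b x, ?_, ?_⟩
    · split_ifs with hx
      · simpa using hδ.le
      · have h1 := hG m {x} (by simpa using hx)
        rw [Finset.sum_singleton] at h1
        rw [zero_sub, norm_neg]
        refine (sq_le_sq₀ (norm_nonneg _) hδ.le).1 ?_
        linarith [he m]
    · filter_upwards [hf m, eventually_gt_atTop 0] with l hl hl0
      refine (ENNReal.rpow_le_rpow_iff two_pos).1 ((avgPow_one_sq_le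
        (hfm.aestronglyMeasurable.sub hc.aestronglyMeasurable) hl0).trans ?_)
      rw [hsq δ hδ]
      exact hl.trans (ENNReal.ofReal_le_ofReal hm)

/-! ### Uniqueness of Fourier series in `B¹` -/

/-- A bounded function of the form `conj z * q (|z|²)`, with a polynomial `q`, that approximates
the conjugate of the sign on a disc. -/
theorem exists_polynomial_sign {R ε : ℝ} (hR : 1 ≤ R) (hε : 0 < ε) :
    ∃ q : Polynomial ℝ, ∀ r : ℝ, 0 ≤ r → r ≤ R →
      |r * q.eval (r ^ 2)| ≤ 2 ∧ r - 2 * ε ≤ r ^ 2 * q.eval (r ^ 2) := by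
  have hR0 : 0 < R := one_pos.trans_le hR
  -- At `x = r ^ 2` the target function gives `r / (r + ε) ≤ 1` and `r ^ 2 / (r + ε) ≥ r - ε`.
  have hcont : ContinuousOn (fun x : ℝ => 1 / (Real.sqrt x + ε)) (Set.Icc 0 (R ^ 2)) := by
    refine ContinuousOn.div continuousOn_const (by fun_prop) fun x _ => ?_
    have := Real.sqrt_nonneg x
    positivity
  -- This accuracy makes the error `d` satisfy `r ^ 2 * |d| ≤ min 1 ε`, and `r * |d| ≤ 1` because `1
  -- ≤ R`.
  obtain ⟨q, hq⟩ := exists_polynomial_near_of_continuousOn 0 (R ^ 2) _ hcont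
    (min 1 ε / R ^ 2) (by positivity)
  refine ⟨q, fun r hr hrR => ?_⟩
  have h1 := (hq (r ^ 2) ⟨by positivity, by gcongr⟩).le
  rw [Real.sqrt_sq hr, le_div_iff₀ (by positivity)] at h1
  set d := Polynomial.eval (r ^ 2) q - 1 / (r + ε) with hd
  have hqe : Polynomial.eval (r ^ 2) q = d + 1 / (r + ε) := by rw [hd]; ring
  have hrε : 0 < r + ε := by linarith
  have h2 : r ^ 2 * |d| ≤ min 1 ε := by
    refine le_trans ?_ h1
    rw [mul_comm]
    gcongr
  have h3 : r * |d| ≤ 1 := by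
    refine le_trans ?_ (h1.trans (min_le_left _ _))
    rw [mul_comm]
    gcongr
    nlinarith
  have h4 : r * (1 / (r + ε)) ≤ 1 := by
    rw [mul_one_div, div_le_one hrε]; linarith
  have h5 : r - ε ≤ r ^ 2 * (1 / (r + ε)) := by
    rw [mul_one_div, le_div_iff₀ hrε]; nlinarith
  rw [hqe]
  constructor
  · calc |r * (d + 1 / (r + ε))| ≤ |r * d| + |r * (1 / (r + ε))| := by
          rw [mul_add]; exact abs_add_le _ _
      _ ≤ 1 + 1 := by
          rw [abs_mul, abs_of_nonneg hr, abs_of_nonneg (by positivity : 0 ≤ r * (1 / (r + ε)))]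
          exact add_le_add h3 h4
      _ = 2 := by norm_num
  · have h6 : -ε ≤ r ^ 2 * d := by
      have := mul_le_mul_of_nonneg_left (neg_abs_le d) (sq_nonneg r)
      linarith [min_le_right 1 ε]
    linarith

/-- With `Q = conj P * q(|P|²)`, both `|Q|` and `P Q` depend on `|P|` alone. As a polynomial in `P`
and `conj P`, `Q` is again trigonometric. -/
theorem exists_trigPolynomial_sign {P : ℝ → ℂ} (hP : IsTrigPolynomial P) {ε : ℝ} (hε : 0 < ε) :
    ∃ Q : ℝ → ℂ, IsTrigPolynomial Q ∧ ∀ t, ‖Q t‖ ≤ 2 ∧ ‖P t‖ - 2 * ε ≤ (P t * Q t).re := by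
  obtain ⟨R, hR⟩ := hP.exists_norm_le
  obtain ⟨q, hq⟩ := exists_polynomial_sign (le_max_left 1 R) hε
  have hcast : ∀ t, (q.map (algebraMap ℝ ℂ)).eval (P t * conj (P t)) =
      ((q.eval (‖P t‖ ^ 2) : ℝ) : ℂ) := fun t => by
    rw [Complex.mul_conj', ← Complex.ofReal_pow]
    exact Polynomial.eval_map_apply (algebraMap ℝ ℂ) (‖P t‖ ^ 2)
  refine ⟨_, hP.conj.mul ((hP.mul hP.conj).polynomial_eval (q.map (algebraMap ℝ ℂ))),
    fun t => ?_⟩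
  obtain ⟨h1, h2⟩ := hq ‖P t‖ (norm_nonneg _) ((hR t).trans (le_max_right _ _))
  rw [hcast]
  constructor
  · rwa [norm_mul, RCLike.norm_conj, Complex.norm_real, ← abs_norm (P t), Real.norm_eq_abs,
      ← abs_mul, abs_norm]
  · rwa [← mul_assoc, Complex.mul_conj', ← Complex.ofReal_pow, ← Complex.ofReal_mul,
      Complex.ofReal_re]

theorem hasMean_mul_trigPolynomial {f : ℝ → ℂ} (hf : CenteredIntegrable f)
    (h : ∀ x, HasFourierCoeff f x 0) {Q : ℝ → ℂ} (hQ : IsTrigPolynomial Q) :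
    HasMean (fun t => f t * Q t) 0 := by
  obtain ⟨s, c, hc⟩ := hQ.conj
  have := hasMean_mul_conj_trigSum hf (a := fun _ => 0) s (fun x _ => h x) c
  simp only [mul_zero, Finset.sum_const_zero] at this
  convert this using 3 with t
  rw [trigSum, ← hc, Complex.conj_conj]

/-- **Uniqueness**: a function in `B¹` whose Fourier coefficients vanish is null. -/
theorem InB.seminorm_eq_zero {f : ℝ → ℂ} (hf : InB 1 f) (h : ∀ x, HasFourierCoeff f x 0) :
    seminorm 1 f = 0 := by
  have hfi := hf.centeredIntegrable
  -- The 6 is `3 + 1 + 2`: three times the error of `P`, the mean of `f Q`, and the defect of the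
  -- sign approximation.
  have main : ∀ ε : ℝ, 0 < ε → seminorm 1 f ≤ ENNReal.ofReal (6 * ε) := fun ε hε => by
    obtain ⟨P, hP, hfP⟩ := hf.2 (ENNReal.ofReal ε) (by simpa using hε)
    obtain ⟨Q, hQ, hPQ⟩ := exists_trigPolynomial_sign hP hε
    have hPc := hP.continuous
    have hQc := hQ.continuous
    have hfPi := hfi.sub hPc.centeredIntegrable
    have hmean := Metric.tendsto_nhds.1 (hasMean_mul_trigPolynomial hfi h hQ) ε hε
    refine seminorm_le one_pos ?_
    filter_upwards [eventually_avgPow_lt one_pos hfP, hmean, eventually_gt_atTop 0] with l h1 h2 hl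
    have hle : -l ≤ l := by linarith
    rw [ENNReal.rpow_one, avgPow_one_eq_ofReal hl.le (hfPi l),
      ENNReal.ofReal_lt_ofReal_iff hε] at h1
    rw [ENNReal.rpow_one, avgPow_one_eq_ofReal hl.le (hfi l)]
    refine ENNReal.ofReal_le_ofReal ?_
    rw [dist_zero_right] at h2
    have h3 : (2 * l)⁻¹ * ∫ t in (-l)..l, (f t * Q t).re ≤ ε := by
      refine le_trans ?_ h2.le
      refine le_trans (le_of_eq ?_) (Complex.re_le_norm _)
      rw [Complex.re_ofReal_mul]
      congr 1
      exact Complex.reCLM.intervalIntegral_comp_comm (hfi.mul_continuous hQc l)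
    have hre : IntervalIntegrable (fun t => (f t * Q t).re) volume (-l) l := by
      rw [intervalIntegrable_iff_integrableOn_Ioc_of_le hle]
      exact ((intervalIntegrable_iff_integrableOn_Ioc_of_le hle).1 (hfi.mul_continuous hQc l)).re
    -- Replacing `f` by `P` costs `‖f - P‖` in the modulus and, as `‖Q‖ ≤ 2`, twice that in the
    -- pairing with `Q`.
    have hpt : ∀ t, ‖f t‖ ≤ 3 * ‖f t - P t‖ + (f t * Q t).re + 2 * ε := fun t => by
      obtain ⟨h4, h5⟩ := hPQ t
      have h6 : ‖f t‖ ≤ ‖f t - P t‖ + ‖P t‖ := by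
        simpa using norm_add_le (f t - P t) (P t)
      have h7 : (P t * Q t).re = (f t * Q t).re - ((f t - P t) * Q t).re := by
        rw [← Complex.sub_re]; congr 1; ring
      have h8 : -((f t - P t) * Q t).re ≤ ‖f t - P t‖ * 2 := by
        refine (neg_le_abs _).trans ((Complex.abs_re_le_norm _).trans ?_)
        rw [norm_mul]
        gcongr
      linarith
    have hint1 := (hfPi l).norm.const_mul 3
    have hint2 : IntervalIntegrable (fun _ : ℝ => 2 * ε) volume (-l) l := intervalIntegrable_const
    have h9 := intervalIntegral.integral_mono_on hle (hfi l).norm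
      ((hint1.add hre).add hint2) fun t _ => hpt t
    rw [intervalIntegral.integral_add (hint1.add hre) hint2, intervalIntegral.integral_add hint1 hre,
      intervalIntegral.integral_const_mul, intervalIntegral.integral_const, smul_eq_mul] at h9
    have hinv : 0 < (2 * l)⁻¹ := by positivity
    have h10 := mul_le_mul_of_nonneg_left h9 hinv.le
    have h11 : (2 * l)⁻¹ * ((l - -l) * (2 * ε)) = 2 * ε := by field_simp; ring
    rw [mul_add, mul_add, h11, mul_left_comm] at h10
    linarith
  refine le_antisymm (le_of_forall_gt fun δ hδ => ?_) bot_le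
  obtain ⟨r, -, hr0, hr⟩ := ENNReal.lt_iff_exists_real_btwn.1 hδ
  have hr0' : 0 < r := ENNReal.ofReal_pos.1 hr0
  refine (main (r / 6) (by positivity)).trans_lt ?_
  rwa [mul_div_cancel₀ _ (by norm_num)]

/-! ### Equivalent Fourier series -/

/-- Extension by zero turns the series into one function of all real frequencies, so the analysis
needs no enumeration of exponents. -/
theorem HasFourierSeries.coeff_extend {N : ℕ∞} {f : ℝ → ℂ} {freq : Index N → ℝ}
    {a : Index N → ℂ} (hinj : Function.Injective freq) (h : HasFourierSeries f freq a) (x : ℝ) :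
    HasFourierCoeff f x (Function.extend freq a 0 x) := by
  by_cases hx : x ∈ Set.range freq
  · obtain ⟨j, rfl⟩ := hx
    rw [hinj.extend_apply]
    exact h.1 j
  · rw [Function.extend_apply' _ _ _ hx]
    exact h.2 x hx

theorem hasFourierSeries_of_coeff_extend {N : ℕ∞} {f : ℝ → ℂ} {freq : Index N → ℝ}
    {a : Index N → ℂ} (hinj : Function.Injective freq)
    (h : ∀ x, HasFourierCoeff f x (Function.extend freq a 0 x)) : HasFourierSeries f freq a := by
  refine ⟨fun j => by simpa only [hinj.extend_apply] using h (freq j), fun x hx => ?_⟩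
  have := h x
  rwa [Function.extend_apply' _ _ _ hx] at this

theorem SeriesEquiv.symm {N : ℕ∞} {freq : Index N → ℝ} {a b : Index N → ℂ}
    (h : SeriesEquiv freq a b) : SeriesEquiv freq b a := fun n h1 h2 => by
  obtain ⟨ψ, hψ⟩ := h n h1 h2
  refine ⟨-ψ, fun j hj => ?_⟩
  rw [hψ j hj, mul_assoc, ← Complex.exp_add]
  simp

theorem SeriesEquiv.norm_eq {N : ℕ∞} {freq : Index N → ℝ} {a b : Index N → ℂ}
    (h : SeriesEquiv freq a b) (j : Index N) : ‖b j‖ = ‖a j‖ := by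
  -- Indices start at 0, so `j.1 + 1` exponents are needed to reach `freq j`.
  obtain ⟨ψ, hψ⟩ := h (j.1 + 1) (by omega) (by
    have := Order.add_one_le_of_lt j.2
    exact_mod_cast this)
  rw [hψ j (Nat.lt_succ_self _), norm_mul, mul_comm Complex.I, Complex.norm_exp_ofReal_mul_I,
    mul_one]

/-- Square-integrability passes to equivalent series: if `∑ a_j e^{i λ_j t}` is the Fourier series
of a function in `B²`, then so is every series equivalent to it. -/
theorem exists_inB_two_hasFourierSeries {N : ℕ∞} {freq : Index N → ℝ} {a b : Index N → ℂ}
    {f : ℝ → ℂ} (hinj : Function.Injective freq) (hf : InB 2 f) (ha : HasFourierSeries f freq a)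
    (hab : SeriesEquiv freq a b) : ∃ h : ℝ → ℂ, InB 2 h ∧ HasFourierSeries h freq b := by
  obtain ⟨C, hC⟩ := hf.exists_sum_normSq_le (ha.coeff_extend hinj)
  have hnorm : ∀ x, ‖Function.extend freq b 0 x‖ = ‖Function.extend freq a 0 x‖ := fun x => by
    by_cases hx : x ∈ Set.range freq
    · obtain ⟨j, rfl⟩ := hx
      rw [hinj.extend_apply, hinj.extend_apply, hab.norm_eq]
    · rw [Function.extend_apply' _ _ _ hx, Function.extend_apply' _ _ _ hx]
  obtain ⟨h, h1, h2⟩ := exists_inB_two (b := Function.extend freq b 0) (by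
    simp only [hnorm]
    exact summable_of_sum_le (fun _ => by positivity) hC)
  exact ⟨h, h1, hasFourierSeries_of_coeff_extend hinj h2⟩

theorem SameClass.hasFourierCoeff {f g : ℝ → ℂ} (h : SameClass f g)
    (hf : AEStronglyMeasurable f volume) (hfi : CenteredIntegrable f)
    (hg : AEStronglyMeasurable g volume) {x : ℝ} {m : ℂ} (hm : HasFourierCoeff f x m) :
    HasFourierCoeff g x m := by
  -- The function `f` itself approximates `g` to every accuracy.
  refine hasFourierCoeff_of_approx hg fun ε hε => ⟨f, m, hfi, hf, hm, by simpa using hε.le, ?_⟩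
  have h0 : seminorm 1 (fun t => f t - g t) < ENNReal.ofReal ε := by
    rw [show seminorm 1 _ = 0 from h]
    simpa using hε
  filter_upwards [eventually_avgPow_lt one_pos h0] with l hl
  rw [ENNReal.rpow_one] at hl
  exact (le_of_eq (avgPow_congr_norm (fun t => norm_sub_rev _ _) l)).trans hl.le

theorem InB.sub {f g : ℝ → ℂ} (hf : InB 1 f) (hg : InB 1 g) : InB 1 (fun t => f t - g t) := by
  refine ⟨hf.1.sub hg.1, fun ε hε => ?_⟩
  obtain ⟨δ, hδ0, hδ⟩ := exists_between hε
  obtain ⟨P, hP, hfP⟩ := hf.2 (δ / 2) (ENNReal.half_pos hδ0.ne')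
  obtain ⟨Q, hQ, hgQ⟩ := hg.2 (δ / 2) (ENNReal.half_pos hδ0.ne')
  refine ⟨_, hP.add ((isTrigPolynomial_const (-1)).mul hQ), (seminorm_le one_pos ?_).trans_lt hδ⟩
  filter_upwards [eventually_avgPow_lt one_pos hfP, eventually_avgPow_lt one_pos hgQ] with l h1 h2
  rw [ENNReal.rpow_one] at *
  calc avgPow 1 (fun t => f t - g t - (P t + -1 * Q t)) l
      = avgPow 1 (fun t => (f t - P t) + (Q t - g t)) l :=
        avgPow_congr_norm (fun t => by congr 1; ring) l
    _ ≤ avgPow 1 (fun t => f t - P t) l + avgPow 1 (fun t => Q t - g t) l :=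
        avgPow_one_add_le (hf.1.sub hP.continuous.aestronglyMeasurable) l
    _ = avgPow 1 (fun t => f t - P t) l + avgPow 1 (fun t => g t - Q t) l := by
        rw [avgPow_congr_norm (fun t => norm_sub_rev (Q t) (g t))]
    _ ≤ δ / 2 + δ / 2 := add_le_add h1.le h2.le
    _ = δ := ENNReal.add_halves δ

/-- Functions in `B¹` with the same Fourier series define the same class. -/
theorem InB.sameClass {f g : ℝ → ℂ} (hf : InB 1 f) (hg : InB 1 g) {a : ℝ → ℂ}
    (hfa : ∀ x, HasFourierCoeff f x (a x)) (hga : ∀ x, HasFourierCoeff g x (a x)) :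
    SameClass f g := by
  refine (hf.sub hg).seminorm_eq_zero fun x => ?_
  have hc : Continuous fun t : ℝ => Complex.exp (-(Complex.I * (x : ℂ) * (t : ℂ))) := by fun_prop
  have := HasMean.sub (hf.centeredIntegrable.mul_continuous hc)
    (hg.centeredIntegrable.mul_continuous hc) (hfa x) (hga x)
  unfold HasFourierCoeff
  simpa only [sub_self, sub_mul] using this

end Besicovitch

end

theorem mainTheorem7 :
    (∀ (N : ℕ∞) (freq : Besicovitch.Index N → ℝ) (a b : Besicovitch.Index N → ℂ) (f₁ : ℝ → ℂ),
      Function.Injective freq →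
      Besicovitch.InB 2 f₁ →
      Besicovitch.HasFourierSeries f₁ freq a →
      Besicovitch.SeriesEquiv freq b a →
      ∃ f₂ : ℝ → ℂ, Besicovitch.InB 2 f₂ ∧ Besicovitch.HasFourierSeries f₂ freq b ∧
        Besicovitch.FunEquiv f₁ f₂) ∧
    (∀ f₁ f₂ : ℝ → ℂ,
      Besicovitch.InB 1 f₁ →
      Besicovitch.InB 1 f₂ →
      Besicovitch.FunEquiv f₁ f₂ →
      Besicovitch.ClassInB2 f₁ →
      Besicovitch.ClassInB2 f₂) := by
  refine ⟨fun N freq a b f₁ hinj hf₁ ha hba => ?_, fun f₁ f₂ hf₁ hf₂ heq hcl => ?_⟩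
  · obtain ⟨f₂, hf₂, hb⟩ :=
      Besicovitch.exists_inB_two_hasFourierSeries hinj hf₁ ha hba.symm
    exact ⟨f₂, hf₂, hb, hf₁.one_of_two, hf₂.one_of_two, N, freq, a, b, hinj, ha, hb, hba.symm⟩
  · obtain ⟨-, -, N, freq, a, b, hinj, ha, hb, hab⟩ := heq
    obtain ⟨g, hg, hfg⟩ := hcl
    -- Fourier coefficients depend only on the class, so the `B²` representative inherits the series
    -- of `f₁`.
    have hga : Besicovitch.HasFourierSeries g freq a :=
      Besicovitch.hasFourierSeries_of_coeff_extend hinj fun x =>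
        hfg.hasFourierCoeff hf₁.1 hf₁.centeredIntegrable hg.1 (ha.coeff_extend hinj x)
    obtain ⟨h, hh, hhb⟩ := Besicovitch.exists_inB_two_hasFourierSeries hinj hg hga hab
    exact ⟨h, hh, hf₂.sameClass hh.one_of_two (hb.coeff_extend hinj) (hhb.coeff_extend hinj)⟩
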